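/- Let $(R,\mathfrak m)$ be a regular (noetherian) local ring of dimension $2$. Let $\mathcal V$ be the set of all normalized proper valuations centered at $R$, that is, of all maps $\nu:R\to\mathbb R\cup\{\infty\}$ with $\nu(0)=\infty$, $\nu(1)=0$, $\nu(fg)=\nu(f)+\nu(g)$ and $\nu(f+g)\ge\min\{\nu(f),\nu(g)\}$ for all $f,g\in R$, such that $\nu\ge 0$ on $R$, $\nu>0$ on $\mathfrak m$, $\nu(R\setminus\{0\})\neq\{0\}$, $\nu(\mathfrak m)\ne\{\infty\}$ and $\inf\{\nu(f)\mid f\in\mathfrak m\}=1$ (the prime ideal $\nu^{-1}(\infty)$ is allowed to be non-zero). Order $\mathcal V$ by $\mu\le\nu$ if and only if $\mu(f)\le\nu(f)$ for all $f\in R$. Then any two elements $\mu,\nu\in\mathcal V$ have an infimum in the poset $\mathcal V$: there is $\sigma\in\mathcal V$ with $\sigma\le\mu$ and $\sigma\le\nu$ such that every $\sigma'\in\mathcal V$ with $\sigma'\le\mu$ and $\sigma'\le\nu$ satisfies $\sigma'\le\sigma$. -/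

import Mathlib

open IsLocalRing

/-!
Valuations are maps `ν : R → ℝ ∪ {∞}` with `ν 0 = ∞`, `ν 1 = 0`, `ν (f * g) = ν f + ν g` and
`ν (f + g) ≥ min (ν f) (ν g)`; this is Mathlib's `AddValuation R (WithTop ℝ)`. The prime ideal
`ν⁻¹(∞)` need not be zero. On the field of fractions such a map is extended by
`ν (g₁ / g₂) = ν g₁ - ν g₂` (for `ν g₂ ≠ ∞`), so it is determined by its values on `R`.
-/

namespace ValuationSpace

variable {R : Type*} [CommRing R] [IsLocalRing R]

/-- `ν` is centered at `R`: non-negative on `R` and strictly positive on the maximal ideal. -/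
def IsCentered (ν : AddValuation R (WithTop ℝ)) : Prop :=
  (∀ f : R, 0 ≤ ν f) ∧ ∀ f ∈ maximalIdeal R, 0 < ν f

/-- `ν` is proper: it is not identically `0` on the non-zero elements, and it is not identically
`∞` on the maximal ideal. -/
def IsProper (ν : AddValuation R (WithTop ℝ)) : Prop :=
  ν '' {f : R | f ≠ 0} ≠ {0} ∧ ν '' (maximalIdeal R : Set R) ≠ {⊤}

/-- `ν` is normalized: the infimum of the values of `ν` on the maximal ideal is `1`. -/
def IsNormalized (ν : AddValuation R (WithTop ℝ)) : Prop :=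
  IsGLB (ν '' (maximalIdeal R : Set R)) 1

end ValuationSpace

/-- The set `𝒱` of normalized proper valuations centered at the local ring `R`. When `R` is noetherian, every proper
centered valuation has exactly one positive real multiple in this set, so these are the chosen
representatives of the proper centered valuations up to multiplication by a constant. -/
structure ValuationSpace (R : Type*) [CommRing R] [IsLocalRing R] where
  /-- The underlying valuation. -/
  val : AddValuation R (WithTop ℝ)
  centered : ValuationSpace.IsCentered val
  proper : ValuationSpace.IsProper val
  normalized : ValuationSpace.IsNormalized val

namespace ValuationSpace

variable {R : Type*} [CommRing R] [IsLocalRing R]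

/-- The order on `𝒱`: `μ ≤ ν` if `μ f ≤ ν f` for all `f ∈ R`. -/
instance : PartialOrder (ValuationSpace R) where
  le μ ν := ∀ f : R, μ.val f ≤ ν.val f
  le_refl _ _ := le_refl _
  le_trans _ _ _ h₁ h₂ f := (h₁ f).trans (h₂ f)
  le_antisymm μ ν h₁ h₂ := by
    have h : μ.val = ν.val := AddValuation.ext fun f => le_antisymm (h₁ f) (h₂ f)
    cases μ
    cases ν
    cases h
    rfl

end ValuationSpace

/-! The lower bounds of `μ` and `ν` form a non-empty chain, and its pointwise supremum is the
infimum sought.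

Non-empty: the `𝔪`-adic order is a valuation because the associated graded ring of `R` is a
polynomial ring in two variables, and it lies below every normalized valuation (`exists_isBot`).

Chain: elements below a fixed `μ` are comparable (`le_total_of_le_of_map_eq_one`). Choose generators
`x, y` of `𝔪` with `μ x = 1`; every normalized valuation below `μ` then also gives `x` the value
`1`. If `σ ≠ μ`, let `φ` have least order in `y` modulo `x` among the elements with `σ φ < μ φ`.
Division by `φ` leaves remainders on which `σ` and `μ` agree, up to high powers of `x`, so `σ` is
determined by `μ`, `φ` and `σ φ`. Comparing such key elements compares the valuations.

Supremum: along a chain the valuation axioms pass to pointwise suprema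
(`exists_addValuation_isLUB`). The supremum takes the value `1` at `x`, hence is normalized. -/

namespace ValuationSpace

/-! ### Valuations below a fixed one are comparable. -/

section Tree

variable {R : Type*} [CommRing R]

/-- `g` has order `e` in `y` modulo `x`: it is a unit times `y ^ e` modulo `x`. -/
def HasResidualOrder (x y : R) (e : ℕ) (g : R) : Prop :=
  ∃ u h : R, IsUnit u ∧ g = u * y ^ e + x * h

theorem mem_or_hasResidualOrder [IsLocalRing R] {x y : R}
    (hm : maximalIdeal R = Ideal.span {x, y}) (d : ℕ) (g : R) :
    (∃ a h, g = a * y ^ d + x * h) ∨ ∃ e < d, HasResidualOrder x y e g := by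
  induction d with
  | zero => exact Or.inl ⟨g, 0, by simp⟩
  | succ d ih =>
    rcases ih with ⟨a, h, rfl⟩ | ⟨e, he, h⟩
    · by_cases ha : IsUnit a
      · exact Or.inr ⟨d, d.lt_succ_self, a, h, ha, rfl⟩
      · have : a ∈ Ideal.span {x, y} := hm ▸ (mem_maximalIdeal a).2 ha
        obtain ⟨b, c, rfl⟩ := Ideal.mem_span_pair.1 this
        exact Or.inl ⟨c, b * y ^ d + h, by ring⟩
    · exact Or.inr ⟨e, he.trans d.lt_succ_self, h⟩

/-- Approximate division with remainder by an element of order `d` in `y` modulo `x`. -/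
theorem HasResidualOrder.exists_eq_mul_add [IsLocalRing R] {x y : R}
    (hm : maximalIdeal R = Ideal.span {x, y}) {d : ℕ} {φ : R} (hφ : HasResidualOrder x y d φ)
    (n : ℕ) (f : R) :
    ∃ q r, f = q * φ + r ∧ ((∃ s, r = x ^ n * s) ∨
      ∃ k g, r = x ^ k * g ∧ ∃ e < d, HasResidualOrder x y e g) := by
  induction n with
  | zero => exact ⟨0, f, by simp, Or.inl ⟨f, by simp⟩⟩
  | succ n ih =>
    obtain ⟨q, r, rfl, ⟨s, rfl⟩ | hr⟩ := ih
    -- Modulo `x`, `y ^ d` is a unit multiple of `φ`: subtracting a multiple of `φ` raises the power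
    -- of `x` in the remainder, unless `s` has order below `d`.
    · rcases mem_or_hasResidualOrder hm d s with ⟨a, h, rfl⟩ | hs
      · obtain ⟨u, t, ⟨u, rfl⟩, rfl⟩ := hφ
        refine ⟨q + x ^ n * a * ↑u⁻¹, x ^ (n + 1) * (h - a * ↑u⁻¹ * t), ?_, Or.inl ⟨_, rfl⟩⟩
        linear_combination (-x ^ n * a * y ^ d) * u.inv_mul
      · exact ⟨q, _, rfl, Or.inr ⟨n, s, rfl, hs⟩⟩
    · exact ⟨q, r, rfl, Or.inr hr⟩

theorem le_of_forall_min_natCast_le {a b : WithTop ℝ}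
    (h : ∀ N : ℕ, min a ((N : ℝ) : WithTop ℝ) ≤ b) : a ≤ b := by
  induction b with
  | top => exact le_top
  | coe b =>
    obtain ⟨N, hN⟩ := exists_nat_gt b
    exact (min_le_iff.1 (h N)).resolve_right (not_le.2 (WithTop.coe_lt_coe.2 hN))

variable {σ τ μ : AddValuation R (WithTop ℝ)}

theorem natCast_le_map_pow_mul (h0 : ∀ f, 0 ≤ σ f) {x : R} (hx : 1 ≤ σ x) (n : ℕ) (s : R) :
    ((n : ℝ) : WithTop ℝ) ≤ σ (x ^ n * s) := by
  rw [AddValuation.map_mul, AddValuation.map_pow]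
  calc ((n : ℝ) : WithTop ℝ) = n • (1 : WithTop ℝ) + 0 := by simp
    _ ≤ _ := add_le_add (nsmul_le_nsmul_right hx n) (h0 s)

/-- Cancellation between `q * φ` and `r` would give both `q * φ` and the sum a `μ`-value above `σ
r`, hence `μ r > σ r`. -/
theorem map_add_eq_min_of_lt (hle : ∀ f, σ f ≤ μ f) {φ r : R} (hφ : σ φ < μ φ)
    (hr : σ r = μ r) (q : R) : σ (q * φ + r) = min (σ (q * φ)) (σ r) := by
  by_cases heq : σ (q * φ) = σ r
  · refine le_antisymm ?_ (σ.map_add _ _)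
    rw [heq, min_self]
    by_contra! hlt
    have hfin : σ (q * φ) ≠ ⊤ := by rw [heq]; exact hlt.ne_top
    have hq : σ q ≠ ⊤ := fun h ↦ hfin (by rw [σ.map_mul, h, top_add])
    have h1 : σ r < μ (q * φ) := by
      rw [← heq, σ.map_mul, μ.map_mul]
      calc σ q + σ φ < σ q + μ φ := WithTop.add_lt_add_left hq hφ
        _ ≤ _ := add_le_add_left (hle q) _
    have h2 : σ r < μ (q * φ + r - q * φ) :=
      lt_of_lt_of_le (lt_min (hlt.trans_le (hle _)) h1) (μ.map_sub _ _)
    rw [add_sub_cancel_left, hr] at h2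
    exact lt_irrefl _ h2
  · exact σ.map_add_of_distinct_val heq

/-- There is no cancellation for `σ` in `f = q * φ + r`, so it suffices to bound both terms. The
bound is proved up to level `N`, by induction: passing from `q` to `q * φ` gains at least `1`
because `1 ≤ σ φ`. -/
theorem le_of_key_element [IsLocalRing R] {x y : R} (hm : maximalIdeal R = Ideal.span {x, y})
    (hσ0 : ∀ f, 0 ≤ σ f) (hτ0 : ∀ f, 0 ≤ τ f) (hσμ : ∀ f, σ f ≤ μ f)
    (hσx : σ x = 1) (hτx : τ x = 1) (hμx : μ x = 1)
    {d : ℕ} {φ : R} (hφd : HasResidualOrder x y d φ) (hφ : σ φ < μ φ) (hφ1 : 1 ≤ σ φ)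
    (hφτ : σ φ ≤ τ φ)
    (hσd : ∀ e < d, ∀ g, HasResidualOrder x y e g → σ g = μ g)
    (hτd : ∀ e < d, ∀ g, HasResidualOrder x y e g → τ g = μ g) (f : R) : σ f ≤ τ f := by
  refine le_of_forall_min_natCast_le fun N ↦ ?_
  induction N generalizing f with
  | zero => exact (min_le_right _ _).trans (by simpa using hτ0 f)
  | succ N ih =>
    have key : ∀ q, min (σ (q * φ)) ((N + 1 : ℕ) : ℝ) ≤ τ (q * φ) := by
      intro q
      rw [τ.map_mul, σ.map_mul]
      refine le_trans ?_ (add_le_add (ih q) hφτ)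
      rcases le_total (σ q) ((N : ℝ) : WithTop ℝ) with h | h
      · rw [min_eq_left h]; exact min_le_left _ _
      · rw [min_eq_right h]
        refine (min_le_right _ _).trans ?_
        push_cast
        exact add_le_add_right hφ1 _
    obtain ⟨q, r, rfl, ⟨s, rfl⟩ | ⟨k, g, rfl, e, he, hg⟩⟩ := hφd.exists_eq_mul_add hm (N + 1) f
    · refine τ.map_le_add (le_trans (le_min ?_ (min_le_right _ _)) (key q))
        ((min_le_right _ _).trans (natCast_le_map_pow_mul hτ0 hτx.ge _ _))
      have := σ.map_sub (q * φ + x ^ (N + 1) * s) (x ^ (N + 1) * s)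
      rw [add_sub_cancel_right] at this
      exact le_trans (min_le_min_left _ (natCast_le_map_pow_mul hσ0 hσx.ge _ _)) this
    · have hr : ∀ v : AddValuation R (WithTop ℝ), v x = 1 → v g = μ g →
          v (x ^ k * g) = μ (x ^ k * g) := by
        intro v h1 h2
        simp only [AddValuation.map_mul, AddValuation.map_pow, h1, h2, hμx]
      have hσr := hr σ hσx (hσd e he g hg)
      rw [map_add_eq_min_of_lt hσμ hφ hσr]
      refine τ.map_le_add (le_trans (min_le_min_right _ (min_le_left _ _)) (key q)) ?_
      rw [hr τ hτx (hτd e he g hg), ← hσr]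
      exact (min_le_left _ _).trans (min_le_right _ _)

/-- With `N > σ f`, dividing `f` by `y ^ N` changes it only by a term of value at least `N`, so the
remainder still separates `σ` from `μ`. It cannot be a multiple of `x ^ N`, and a factor `x ^ k` can
be dropped. -/
theorem exists_hasResidualOrder_lt [IsLocalRing R] {x y : R}
    (hm : maximalIdeal R = Ideal.span {x, y})
    (hσ0 : ∀ f, 0 ≤ σ f) (hσμ : ∀ f, σ f ≤ μ f) (hσx : σ x = 1) (hμx : μ x = 1) (hσy : 1 ≤ σ y)
    {f : R} (hf : σ f < μ f) : ∃ d g, HasResidualOrder x y d g ∧ σ g < μ g := by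
  by_contra! hcon
  obtain ⟨c, hc⟩ := WithTop.ne_top_iff_exists.1 hf.ne_top
  obtain ⟨N, hN⟩ := exists_nat_gt c
  have hN' : σ f < ((N : ℝ) : WithTop ℝ) := by rw [← hc]; exact WithTop.coe_lt_coe.2 hN
  have hy : HasResidualOrder x y N (y ^ N) := ⟨1, 0, isUnit_one, by simp⟩
  obtain ⟨q, r, hqr, hr⟩ := hy.exists_eq_mul_add hm N f
  have hq : ((N : ℝ) : WithTop ℝ) ≤ σ (q * y ^ N) := by
    rw [mul_comm]; exact natCast_le_map_pow_mul hσ0 hσy N q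
  have hr' : σ r = σ f := by
    rw [show r = f - q * y ^ N by rw [hqr]; ring]
    exact σ.map_sub_eq_of_lt_left (hN'.trans_le hq)
  rcases hr with ⟨s, rfl⟩ | ⟨k, g, rfl, e, -, hg⟩
  · exact (hN'.trans_le (natCast_le_map_pow_mul hσ0 hσx.ge N s)).ne hr'.symm
  · have h1 : μ (x ^ k * g) ≤ σ (x ^ k * g) := by
      simp only [AddValuation.map_mul, AddValuation.map_pow, hσx, hμx]
      exact add_le_add_right (hcon e g hg) _
    have h2 : σ f < μ (f - q * y ^ N) :=
      lt_of_lt_of_le (lt_min hf (hN'.trans_le (hq.trans (hσμ _)))) (μ.map_sub _ _)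
    rw [show f - q * y ^ N = x ^ k * g by rw [hqr]; ring, ← hr'] at h2
    exact h2.not_ge h1

theorem one_le_of_lt [IsLocalRing R] (hσ0 : ∀ f, 0 ≤ σ f) (hμ0 : ∀ f, 0 ≤ μ f)
    (hσ1 : ∀ f ∈ maximalIdeal R, 1 ≤ σ f) {φ : R} (hφ : σ φ < μ φ) : 1 ≤ σ φ := by
  refine hσ1 φ ((mem_maximalIdeal φ).2 fun hu ↦ ?_)
  obtain ⟨ψ, hψ⟩ := hu.exists_right_inv
  have h : μ φ + μ ψ = 0 := by rw [← μ.map_mul, hψ, μ.map_one]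
  have h' : μ φ ≤ 0 := h ▸ le_add_of_nonneg_right (hμ0 ψ)
  exact (hφ.trans_le h').not_ge (hσ0 φ)

/-- Normalized centered valuations below a fixed one are comparable, when `x` has value `1`. -/
theorem le_total_of_le_of_map_eq_one [IsLocalRing R] {x y : R}
    (hm : maximalIdeal R = Ideal.span {x, y})
    (hσ0 : ∀ f, 0 ≤ σ f) (hτ0 : ∀ f, 0 ≤ τ f) (hσ1 : ∀ f ∈ maximalIdeal R, 1 ≤ σ f)
    (hτ1 : ∀ f ∈ maximalIdeal R, 1 ≤ τ f) (hσμ : ∀ f, σ f ≤ μ f) (hτμ : ∀ f, τ f ≤ μ f)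
    (hμx : μ x = 1) : (∀ f, σ f ≤ τ f) ∨ ∀ f, τ f ≤ σ f := by
  classical
  have hx : x ∈ maximalIdeal R := hm ▸ Ideal.subset_span (by simp)
  have hy : y ∈ maximalIdeal R := hm ▸ Ideal.subset_span (by simp)
  have hσx : σ x = 1 := le_antisymm (hμx ▸ hσμ x) (hσ1 x hx)
  have hτx : τ x = 1 := le_antisymm (hμx ▸ hτμ x) (hτ1 x hx)
  have hμ0 : ∀ f, 0 ≤ μ f := fun f ↦ (hσ0 f).trans (hσμ f)
  by_cases hσ : ∀ f, μ f ≤ σ f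
  · exact Or.inr fun f ↦ (hτμ f).trans (hσ f)
  by_cases hτ : ∀ f, μ f ≤ τ f
  · exact Or.inl fun f ↦ (hσμ f).trans (hτ f)
  push Not at hσ hτ
  have Hσ : ∃ d g, HasResidualOrder x y d g ∧ σ g < μ g :=
    exists_hasResidualOrder_lt hm hσ0 hσμ hσx hμx (hσ1 y hy) hσ.choose_spec
  have Hτ : ∃ d g, HasResidualOrder x y d g ∧ τ g < μ g :=
    exists_hasResidualOrder_lt hm hτ0 hτμ hτx hμx (hτ1 y hy) hτ.choose_spec
  have minσ : ∀ e < Nat.find Hσ, ∀ g, HasResidualOrder x y e g → σ g = μ g := fun e he g hg ↦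
    (hσμ g).antisymm (not_lt.1 fun h ↦ Nat.find_min Hσ he ⟨g, hg, h⟩)
  have minτ : ∀ e < Nat.find Hτ, ∀ g, HasResidualOrder x y e g → τ g = μ g := fun e he g hg ↦
    (hτμ g).antisymm (not_lt.1 fun h ↦ Nat.find_min Hτ he ⟨g, hg, h⟩)
  obtain ⟨φ, hφd, hφ⟩ := Nat.find_spec Hσ
  obtain ⟨ψ, hψd, hψ⟩ := Nat.find_spec Hτ
  have leσ (h : Nat.find Hσ ≤ Nat.find Hτ) (hle : σ φ ≤ τ φ) : ∀ f, σ f ≤ τ f :=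
    le_of_key_element hm hσ0 hτ0 hσμ hσx hτx hμx hφd hφ (one_le_of_lt hσ0 hμ0 hσ1 hφ) hle
      minσ fun e he ↦ minτ e (he.trans_le h)
  have leτ (h : Nat.find Hτ ≤ Nat.find Hσ) {χ : R} (hχd : HasResidualOrder x y (Nat.find Hτ) χ)
      (hχ : τ χ < μ χ) (hle : τ χ ≤ σ χ) : ∀ f, τ f ≤ σ f :=
    le_of_key_element hm hτ0 hσ0 hτμ hτx hσx hμx hχd hχ (one_le_of_lt hτ0 hμ0 hτ1 hχ) hle
      minτ fun e he ↦ minσ e (he.trans_le h)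
  rcases lt_trichotomy (Nat.find Hσ) (Nat.find Hτ) with h | h | h
  -- Below its own minimal order `τ` agrees with `μ`, so `τ φ = μ φ > σ φ`.
  · exact Or.inl (leσ h.le (by rw [minτ _ h φ hφd]; exact hφ.le))
  · rcases le_total (σ φ) (τ φ) with hle | hle
    · exact Or.inl (leσ h.le hle)
    -- When the orders tie, `φ` is a key element for `τ` too, since `τ φ ≤ σ φ < μ φ`.
    · exact Or.inr (leτ h.ge (h ▸ hφd) (hle.trans_lt hφ) hle)
  · exact Or.inr (leτ h.le hψd hψ (by rw [minσ _ h ψ hψd]; exact hψ.le))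

end Tree

/-! ### Regular parameters generate primes, and the ring is a domain. -/

section Regular

variable {R : Type*} [CommRing R]

/-- Krull's intersection theorem in `R ⧸ (x)`: only zero is divisible by all powers of `y`. -/
theorem exists_hasResidualOrder_of_notMem [IsLocalRing R] [IsNoetherianRing R] {x y : R}
    (hm : maximalIdeal R = Ideal.span {x, y}) {a : R} (ha : a ∉ Ideal.span {x}) :
    ∃ e, HasResidualOrder x y e a := by
  by_contra! hcon
  have hmem : ∀ d, ∃ b h, a = b * y ^ d + x * h := fun d ↦
    (mem_or_hasResidualOrder hm d a).resolve_right fun ⟨e, _, h⟩ ↦ hcon e h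
  have hy : y ∈ maximalIdeal R := hm ▸ Ideal.subset_span (by simp)
  apply ha
  rw [← Ideal.Quotient.eq_zero_iff_mem]
  have key := Ideal.iInf_pow_smul_eq_bot_of_isLocalRing (M := R ⧸ Ideal.span {x})
    (maximalIdeal R) (maximalIdeal.isMaximal R).ne_top
  rw [← Submodule.mem_bot (R := R), ← key, Submodule.mem_iInf]
  intro d
  obtain ⟨b, h, rfl⟩ := hmem d
  have hx : (Ideal.Quotient.mk (Ideal.span {x})) (b * y ^ d + x * h) =
      y ^ d • (Ideal.Quotient.mk (Ideal.span {x})) b := by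
    rw [map_add, Ideal.Quotient.eq_zero_iff_mem.2 (Ideal.mul_mem_right h _
      (Ideal.mem_span_singleton_self x)), add_zero, mul_comm, map_mul]
    rfl
  rw [hx]
  exact Submodule.smul_mem_smul (Ideal.pow_mem_pow hy d) trivial

theorem maximalIdeal_notMem_minimalPrimes_span_singleton [IsLocalRing R] [IsNoetherianRing R]
    (hdim : ringKrullDim R = 2) (z : R) : maximalIdeal R ∉ (Ideal.span {z}).minimalPrimes := by
  intro h
  have h1 := Ideal.height_le_one_of_isPrincipal_of_mem_minimalPrimes (Ideal.span {z}) _ h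
  have h2 := IsLocalRing.maximalIdeal_height_eq_ringKrullDim (R := R)
  rw [hdim] at h2
  have h3 : (maximalIdeal R).height = 2 := WithBot.coe_inj.1 (h2.trans rfl)
  rw [h3] at h1
  exact absurd h1 (by decide)

/-- Otherwise `𝔪` would be minimal over `(x)`, against Krull's principal ideal theorem. -/
theorem pow_notMem_span_singleton [IsLocalRing R] [IsNoetherianRing R] {x y : R}
    (hdim : ringKrullDim R = 2) (hm : maximalIdeal R = Ideal.span {x, y}) (k : ℕ) :
    y ^ k ∉ Ideal.span {x} := by
  intro h
  apply maximalIdeal_notMem_minimalPrimes_span_singleton hdim x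
  have hxm : x ∈ maximalIdeal R := hm ▸ Ideal.subset_span (by simp)
  refine ⟨⟨inferInstance, (Ideal.span_singleton_le_iff_mem _).2 hxm⟩, fun q ⟨hq, hxq⟩ _ ↦ ?_⟩
  rw [hm, Ideal.span_le, Set.pair_subset_iff]
  exact ⟨hxq (Ideal.mem_span_singleton_self x), hq.mem_of_pow_mem k (hxq h)⟩

/-- Orders in `y` modulo `x` add under multiplication, so a product lying in `(x)` would force a
power of `y` into `(x)`. -/
theorem isPrime_span_singleton [IsLocalRing R] [IsNoetherianRing R] {x y : R}
    (hdim : ringKrullDim R = 2) (hm : maximalIdeal R = Ideal.span {x, y}) :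
    (Ideal.span {x}).IsPrime := by
  refine ⟨fun h ↦ ?_, fun {a b} hab ↦ ?_⟩
  · exact pow_notMem_span_singleton hdim hm 0 (h ▸ trivial)
  · by_contra! hcon
    obtain ⟨e, u, h, hu, rfl⟩ := exists_hasResidualOrder_of_notMem hm hcon.1
    obtain ⟨e', u', h', hu', rfl⟩ := exists_hasResidualOrder_of_notMem hm hcon.2
    obtain ⟨c, hc⟩ := Ideal.mem_span_singleton'.1 hab
    obtain ⟨w, hw⟩ := (hu.mul hu').exists_left_inv
    apply pow_notMem_span_singleton hdim hm (e + e')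
    refine Ideal.mem_span_singleton'.2
      ⟨w * (c - (h * (u' * y ^ e' + x * h') + u * y ^ e * h')), ?_⟩
    linear_combination w * hc + y ^ (e + e') * hw

theorem exists_maximalIdeal_eq_span_pair [IsRegularLocalRing R] (hdim : ringKrullDim R = 2) :
    ∃ x y : R, maximalIdeal R = Ideal.span {x, y} := by
  classical
  have h := IsRegularLocalRing.spanFinrank_maximalIdeal (R := R)
  rw [hdim] at h
  have h2 : (maximalIdeal R).spanFinrank = 2 := by exact_mod_cast h
  obtain ⟨s, hs, hspan⟩ := Submodule.FG.exists_span_finset_card_eq_spanFinrank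
    (IsNoetherian.noetherian (maximalIdeal R))
  obtain ⟨x, y, -, rfl⟩ := Finset.card_eq_two.1 (hs.trans h2)
  exact ⟨x, y, by simpa using hspan.symm⟩

/-- Infinitely many of the ideals `(x + y ^ (k + 1))` are distinct primes, so one of them is not
a minimal prime; a prime strictly below it is zero by Nakayama's lemma. -/
theorem isDomain_of_ringKrullDim_eq_two [IsRegularLocalRing R] (hdim : ringKrullDim R = 2) :
    IsDomain R := by
  obtain ⟨x, y, hm⟩ := exists_maximalIdeal_eq_span_pair (R := R) hdim
  have hy : y ∈ maximalIdeal R := hm ▸ Ideal.subset_span (by simp)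
  have hpair : ∀ k : ℕ, maximalIdeal R = Ideal.span {x + y ^ (k + 1), y} := by
    intro k
    rw [hm, pow_succ, Ideal.span_pair_add_mul_right]
  let z : ℕ → R := fun k ↦ x + y ^ (k + 1)
  have hprime : ∀ k, (Ideal.span {z k}).IsPrime := fun k ↦ isPrime_span_singleton hdim (hpair k)
  have hlt : ∀ k l, k < l → Ideal.span {z k} ≠ Ideal.span {z l} := by
    intro k l hkl h
    have hl : z l ∈ Ideal.span {z k} := h ▸ Ideal.mem_span_singleton_self _
    have hd : z k - z l ∈ Ideal.span {z k} :=
      Ideal.sub_mem _ (Ideal.mem_span_singleton_self _) hl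
    obtain ⟨j, rfl⟩ := Nat.exists_eq_add_of_lt hkl
    have hfac : z k - z (k + j + 1) = y ^ (k + 1) * (1 - y ^ (j + 1)) := by
      simp only [z]; ring
    rw [hfac] at hd
    have hu : IsUnit (1 - y ^ (j + 1)) := by
      by_contra hnu
      have h1 : 1 - y ^ (j + 1) ∈ maximalIdeal R := hnu
      have h2 := Ideal.add_mem _ h1 (Ideal.pow_mem_of_mem _ hy (j + 1) j.succ_pos)
      rw [sub_add_cancel] at h2
      exact (Ideal.ne_top_iff_one _).1 (maximalIdeal.isMaximal R).ne_top h2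
    exact pow_notMem_span_singleton hdim (hpair k) (k + 1)
      ((Ideal.mul_unit_mem_iff_mem _ hu).1 hd)
  have hinj : Function.Injective fun k ↦ Ideal.span {z k} := by
    intro k l h
    rcases lt_trichotomy k l with hkl | hkl | hkl
    · exact absurd h (hlt _ _ hkl)
    · exact hkl
    · exact absurd h.symm (hlt _ _ hkl)
  obtain ⟨k, hk⟩ : ∃ k, Ideal.span {z k} ∉ minimalPrimes R := by
    by_contra! hcon
    exact Set.infinite_of_injective_forall_mem hinj hcon (minimalPrimes.finite_of_isNoetherianRing R)
  have := hprime k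
  obtain ⟨q, hq, hqz⟩ := Ideal.exists_minimalPrimes_le (I := ⊥) (J := Ideal.span {z k}) bot_le
  have hqp : q.IsPrime := hq.1.1
  have hzq : z k ∉ q := fun h ↦ hk (by
    rwa [minimalPrimes, le_antisymm ((Ideal.span_singleton_le_iff_mem _).2 h) hqz])
  have hzm : z k ∈ maximalIdeal R := hpair k ▸ Ideal.subset_span (by simp [z])
  have hq0 : q = ⊥ := by
    refine Submodule.eq_bot_of_le_smul_of_le_jacobson_bot (maximalIdeal R) q
      (IsNoetherian.noetherian q) (fun a ha ↦ ?_) (IsLocalRing.maximalIdeal_le_jacobson _)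
    obtain ⟨b, rfl⟩ := Ideal.mem_span_singleton'.1 (hqz ha)
    rw [mul_comm]
    exact Submodule.smul_mem_smul hzm ((hqp.mem_or_mem ha).resolve_right hzq)
  have : (⊥ : Ideal R).IsPrime := hq0 ▸ hqp
  exact IsDomain.of_bot_isPrime R

end Regular

/-! ### The `𝔪`-adic order is a valuation. -/

section AdicOrder

open Polynomial

variable {R : Type*} [CommRing R]

/-- The value at `(x, y)` of the binary form of degree `n` with coefficients those of `P`. -/
noncomputable def formEval (x y : R) (n : ℕ) (P : R[X]) : R :=
  MvPolynomial.aeval ![y, x] (P.homogenize n)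

theorem formEval_eq_sum (x y : R) (n : ℕ) (P : R[X]) :
    formEval x y n P = ∑ i ∈ Finset.range (n + 1), P.coeff i * (y ^ i * x ^ (n - i)) := by
  rw [formEval, homogenize, map_sum, Finset.Nat.sum_antidiagonal_eq_sum_range_succ_mk]
  refine Finset.sum_congr rfl fun i _ ↦ ?_
  rw [MvPolynomial.aeval_monomial, Finsupp.prod_fintype _ _ (by simp)]
  simp [Fin.prod_univ_two]

theorem formEval_mul (x y : R) {m n : ℕ} {P Q : R[X]} (hP : P.natDegree ≤ m)
    (hQ : Q.natDegree ≤ n) :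
    formEval x y (m + n) (P * Q) = formEval x y m P * formEval x y n Q := by
  rw [formEval, homogenize_mul P Q hP hQ, map_mul]
  rfl

theorem formEval_add (x y : R) (n : ℕ) (P Q : R[X]) :
    formEval x y n (P + Q) = formEval x y n P + formEval x y n Q := by
  simp [formEval]

theorem formEval_sub (x y : R) (n : ℕ) (P Q : R[X]) :
    formEval x y n (P - Q) = formEval x y n P - formEval x y n Q := by
  simp [formEval]

theorem formEval_C_mul (x y : R) (n : ℕ) (a : R) (P : R[X]) :
    formEval x y n (C a * P) = a * formEval x y n P := by
  simp [formEval]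

theorem exists_formEval_eq_of_mem_pow {x y f : R} {n : ℕ} (hf : f ∈ Ideal.span {x, y} ^ n) :
    ∃ P : R[X], P.natDegree ≤ n ∧ formEval x y n P = f := by
  induction n generalizing f with
  | zero => exact ⟨C f, by simp, by simp [formEval_eq_sum]⟩
  | succ n ih =>
    rw [pow_succ] at hf
    refine Submodule.mul_induction_on hf (fun g hg h hh ↦ ?_) ?_
    · obtain ⟨P, hP, rfl⟩ := ih hg
      obtain ⟨a, b, rfl⟩ := Ideal.mem_span_pair.1 hh
      have hd : (C b * X + C a : R[X]).natDegree ≤ 1 := natDegree_linear_le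
      refine ⟨P * (C b * X + C a), natDegree_mul_le_of_le hP hd, ?_⟩
      rw [formEval_mul x y hP hd]
      simp [formEval_eq_sum, Finset.sum_range_succ, coeff_C]
    · rintro _ _ ⟨P, hP, rfl⟩ ⟨Q, hQ, rfl⟩
      exact ⟨P + Q, natDegree_add_le_of_degree_le hP hQ, formEval_add ..⟩

/-- Two-variable quasi-regularity. -/
theorem coeff_mem_of_sum_eq_zero [IsDomain R] {x y : R} (hx0 : x ≠ 0)
    (hx : (Ideal.span {x}).IsPrime) (hy : y ∉ Ideal.span {x}) (n : ℕ) (b : ℕ → R)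
    (hb : ∑ i ∈ Finset.range (n + 1), b i * (y ^ i * x ^ (n - i)) = 0) :
    ∀ i ≤ n, b i ∈ Ideal.span {x, y} := by
  induction n generalizing b with
  | zero =>
    intro i hi
    obtain rfl : i = 0 := by omega
    have : b 0 = 0 := by simpa using hb
    rw [this]
    exact zero_mem _
  | succ n ih =>
    have hfac : ∑ i ∈ Finset.range (n + 1), b i * (y ^ i * x ^ (n + 1 - i)) =
        x * ∑ i ∈ Finset.range (n + 1), b i * (y ^ i * x ^ (n - i)) := by
      rw [Finset.mul_sum]
      refine Finset.sum_congr rfl fun i hi ↦ ?_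
      rw [Nat.sub_add_comm (Nat.lt_succ_iff.1 (Finset.mem_range.1 hi)), pow_succ]
      ring
    rw [Finset.sum_range_succ, hfac, Nat.sub_self, pow_zero, mul_one] at hb
    have hmem : b (n + 1) * y ^ (n + 1) ∈ Ideal.span {x} :=
      Ideal.mem_span_singleton'.2
        ⟨-∑ i ∈ Finset.range (n + 1), b i * (y ^ i * x ^ (n - i)), by linear_combination -hb⟩
    obtain ⟨c, hc⟩ := Ideal.mem_span_singleton'.1
      ((hx.mem_or_mem hmem).resolve_right fun h ↦ hy (hx.mem_of_pow_mem _ h))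
    -- With `b (n + 1) = c * x`, the top term is `x * (c * y) * y ^ n`; it joins the coefficient of
    -- `y ^ n`, and the whole relation is divided by `x`. The correction `c * y` lies in `(x, y)`.
    have hsum : ∑ i ∈ Finset.range (n + 1),
        (if i = n then b n + c * y else b i) * (y ^ i * x ^ (n - i)) = 0 := by
      apply mul_left_cancel₀ hx0
      rw [mul_zero, ← hb, ← hc, Finset.sum_range_succ, Finset.sum_range_succ, if_pos rfl,
        Finset.sum_congr rfl fun i hi ↦ by rw [if_neg (Finset.mem_range.1 hi).ne], Nat.sub_self]
      ring
    intro i hi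
    rcases hi.lt_or_eq with hi | rfl
    · have := ih _ hsum i (Nat.lt_succ_iff.1 hi)
      split_ifs at this with h
      · subst h
        exact (Ideal.add_mem_iff_left _ (Ideal.mul_mem_left _ c (Ideal.subset_span (by simp)))).1
          this
      · exact this
    · rw [← hc]
      exact Ideal.mul_mem_left _ c (Ideal.subset_span (by simp))

variable [IsLocalRing R] {x y : R}

theorem map_residue_eq_zero_iff {P : R[X]} :
    P.map (residue R) = 0 ↔ ∀ i, P.coeff i ∈ maximalIdeal R := by
  simp [Polynomial.ext_iff, residue_eq_zero_iff]

theorem formEval_mem_pow_succ (hm : maximalIdeal R = Ideal.span {x, y}) (n : ℕ) {P : R[X]}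
    (hP : P.map (residue R) = 0) : formEval x y n P ∈ maximalIdeal R ^ (n + 1) := by
  have hx : x ∈ maximalIdeal R := hm ▸ Ideal.subset_span (by simp)
  have hy : y ∈ maximalIdeal R := hm ▸ Ideal.subset_span (by simp)
  rw [formEval_eq_sum]
  refine sum_mem fun i hi ↦ ?_
  rw [pow_succ', ← Nat.add_sub_cancel' (Nat.lt_succ_iff.1 (Finset.mem_range.1 hi)), pow_add,
    Nat.add_sub_cancel_left]
  exact Ideal.mul_mem_mul (map_residue_eq_zero_iff.1 hP i)
    (Ideal.mul_mem_mul (Ideal.pow_mem_pow hy _) (Ideal.pow_mem_pow hx _))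

/-- An element of `𝔪 ^ (n + 1)` is also a form of degree `n` with coefficients in `𝔪`;
quasi-regularity applies to the difference of the two forms. -/
theorem map_residue_eq_zero_of_formEval_mem [IsDomain R] (hm : maximalIdeal R = Ideal.span {x, y})
    (hx0 : x ≠ 0) (hx : (Ideal.span {x}).IsPrime) (hy : y ∉ Ideal.span {x}) {n : ℕ} {P : R[X]}
    (hP : P.natDegree ≤ n) (hmem : formEval x y n P ∈ maximalIdeal R ^ (n + 1)) :
    P.map (residue R) = 0 := by
  have key : ∀ f ∈ maximalIdeal R * maximalIdeal R ^ n, ∃ Q : R[X],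
      Q.natDegree ≤ n ∧ formEval x y n Q = f ∧ Q.map (residue R) = 0 := by
    intro f hf
    refine Submodule.mul_induction_on hf (fun a ha g hg ↦ ?_) ?_
    · rw [hm] at hg
      obtain ⟨Q, hQ, rfl⟩ := exists_formEval_eq_of_mem_pow hg
      refine ⟨C a * Q, (natDegree_C_mul_le a Q).trans hQ, formEval_C_mul .., ?_⟩
      rw [Polynomial.map_mul, map_C, (residue_eq_zero_iff a).2 ha, C_0, zero_mul]
    · rintro _ _ ⟨P, hP, rfl, hP'⟩ ⟨Q, hQ, rfl, hQ'⟩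
      exact ⟨P + Q, natDegree_add_le_of_degree_le hP hQ, formEval_add .., by simp [hP', hQ']⟩
  rw [pow_succ'] at hmem
  obtain ⟨Q, hQ, hPQ, hQ0⟩ := key _ hmem
  have h0 : formEval x y n (P - Q) = 0 := by rw [formEval_sub, hPQ, sub_self]
  rw [formEval_eq_sum] at h0
  have h1 := coeff_mem_of_sum_eq_zero hx0 hx hy n _ h0
  rw [← hm] at h1
  have h2 : (P - Q).map (residue R) = 0 := map_residue_eq_zero_iff.2 fun i ↦ by
    by_cases hi : i ≤ n
    · exact h1 i hi
    · rw [coeff_eq_zero_of_natDegree_lt]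
      · exact zero_mem _
      · exact (natDegree_sub_le_of_le hP hQ).trans_lt (by simpa using hi)
  rwa [Polynomial.map_sub, hQ0, sub_zero] at h2

/-- Initial forms multiply, and polynomials over the residue field have no zero divisors. -/
theorem mul_notMem_pow_succ [IsDomain R] (hm : maximalIdeal R = Ideal.span {x, y})
    (hx0 : x ≠ 0) (hx : (Ideal.span {x}).IsPrime) (hy : y ∉ Ideal.span {x}) {a b : ℕ} {f g : R}
    (hf : f ∈ maximalIdeal R ^ a) (hf' : f ∉ maximalIdeal R ^ (a + 1))
    (hg : g ∈ maximalIdeal R ^ b) (hg' : g ∉ maximalIdeal R ^ (b + 1)) :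
    f * g ∉ maximalIdeal R ^ (a + b + 1) := by
  obtain ⟨P, hP, rfl⟩ := exists_formEval_eq_of_mem_pow (hm ▸ hf)
  obtain ⟨Q, hQ, rfl⟩ := exists_formEval_eq_of_mem_pow (hm ▸ hg)
  rw [← formEval_mul x y hP hQ]
  intro h
  have := map_residue_eq_zero_of_formEval_mem hm hx0 hx hy (natDegree_mul_le_of_le hP hQ) h
  rw [Polynomial.map_mul, mul_eq_zero] at this
  exact this.elim (fun h ↦ hf' (formEval_mem_pow_succ hm a h))
    fun h ↦ hg' (formEval_mem_pow_succ hm b h)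

/-- The largest `n` with `f ∈ 𝔪 ^ n`, for `f ≠ 0`. -/
noncomputable def adicOrder (f : R) : ℕ := sInf {n | f ∉ maximalIdeal R ^ (n + 1)}

theorem adicOrder_spec [IsNoetherianRing R] {f : R} (hf : f ≠ 0) :
    f ∈ maximalIdeal R ^ adicOrder f ∧ f ∉ maximalIdeal R ^ (adicOrder f + 1) := by
  have hne : {n | f ∉ maximalIdeal R ^ (n + 1)}.Nonempty := by
    by_contra! hcon
    apply hf
    rw [← Ideal.mem_bot, ← Ideal.iInf_pow_eq_bot_of_isLocalRing (maximalIdeal R)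
      (maximalIdeal.isMaximal R).ne_top, Ideal.mem_iInf]
    intro n
    by_contra hn
    exact Set.eq_empty_iff_forall_notMem.1 hcon n
      fun h ↦ hn (Ideal.pow_le_pow_right n.le_succ h)
  refine ⟨?_, Nat.sInf_mem hne⟩
  rcases Nat.eq_zero_or_pos (adicOrder f) with h | h
  · simp [h]
  · have hpred : f ∈ maximalIdeal R ^ (adicOrder f - 1 + 1) :=
      not_not.1 (Nat.notMem_of_lt_sInf (Nat.sub_lt h one_pos))
    rwa [Nat.sub_add_cancel h] at hpred

theorem le_adicOrder_iff [IsNoetherianRing R] {f : R} (hf : f ≠ 0) {n : ℕ} :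
    n ≤ adicOrder f ↔ f ∈ maximalIdeal R ^ n := by
  refine ⟨fun h ↦ Ideal.pow_le_pow_right h (adicOrder_spec hf).1, fun h ↦ ?_⟩
  by_contra! hlt
  exact (adicOrder_spec hf).2 (Ideal.pow_le_pow_right hlt h)

theorem adicOrder_eq [IsNoetherianRing R] {f : R} {n : ℕ} (h : f ∈ maximalIdeal R ^ n)
    (h' : f ∉ maximalIdeal R ^ (n + 1)) : adicOrder f = n := by
  have hf : f ≠ 0 := fun h0 ↦ h' (h0 ▸ zero_mem _)
  refine le_antisymm ?_ ((le_adicOrder_iff hf).2 h)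
  by_contra! hlt
  exact h' ((le_adicOrder_iff hf).1 hlt)

open Classical in
/-- The `𝔪`-adic order of a two-dimensional regular local ring, as a valuation. -/
noncomputable def adicValuation [IsNoetherianRing R] [IsDomain R]
    (hm : maximalIdeal R = Ideal.span {x, y}) (hx0 : x ≠ 0) (hx : (Ideal.span {x}).IsPrime)
    (hy : y ∉ Ideal.span {x}) : AddValuation R (WithTop ℝ) :=
  -- Zero is treated apart because `adicOrder 0 = sInf ∅ = 0`.
  AddValuation.of (fun f ↦ if f = 0 then ⊤ else ((adicOrder f : ℝ) : WithTop ℝ))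
    (by simp)
    (by
      have : adicOrder (1 : R) = 0 := adicOrder_eq (by simp) (by simp)
      simp [this])
    (by
      intro f g
      by_cases hf : f = 0
      · simp [hf]
      by_cases hg : g = 0
      · simp [hg]
      by_cases hfg : f + g = 0
      · simp [hfg]
      simp only [hf, hg, hfg, if_false, min_le_iff, WithTop.coe_le_coe, Nat.cast_le]
      rw [← min_le_iff, le_adicOrder_iff hfg]
      exact Ideal.add_mem _ ((le_adicOrder_iff hf).1 (min_le_left _ _))
        ((le_adicOrder_iff hg).1 (min_le_right _ _)))
    (by
      intro f g
      by_cases hf : f = 0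
      · simp [hf]
      by_cases hg : g = 0
      · simp [hg]
      obtain ⟨f1, f2⟩ := adicOrder_spec hf
      obtain ⟨g1, g2⟩ := adicOrder_spec hg
      have : adicOrder (f * g) = adicOrder f + adicOrder g :=
        adicOrder_eq (by rw [pow_add]; exact Ideal.mul_mem_mul f1 g1)
          (mul_notMem_pow_succ hm hx0 hx hy f1 f2 g1 g2)
      simp [hf, hg, this])

end AdicOrder

/-! ### Suprema of chains, and membership in the valuation space. -/

section Infimum

theorem exists_isLUB_withTop_real {S : Set (WithTop ℝ)} (hS : S.Nonempty) : ∃ a, IsLUB S a := by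
  by_cases htop : ∃ b : ℝ, (b : WithTop ℝ) ∈ upperBounds S
  · obtain ⟨b, hb⟩ := htop
    have hlift : ∀ s ∈ S, ∃ t : ℝ, (t : WithTop ℝ) = s := fun s hs ↦
      WithTop.ne_top_iff_exists.1 ((hb hs).trans_lt (WithTop.coe_lt_top b)).ne
    obtain ⟨s, hs⟩ := hS
    obtain ⟨t, rfl⟩ := hlift s hs
    have hT : IsLUB {t : ℝ | (t : WithTop ℝ) ∈ S} (sSup {t : ℝ | (t : WithTop ℝ) ∈ S}) :=
      isLUB_csSup ⟨t, hs⟩ ⟨b, fun u hu ↦ WithTop.coe_le_coe.1 (hb hu)⟩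
    refine ⟨(sSup {t : ℝ | (t : WithTop ℝ) ∈ S} : ℝ), fun s hs ↦ ?_, fun c hc ↦ ?_⟩
    · obtain ⟨t, rfl⟩ := hlift s hs
      exact WithTop.coe_le_coe.2 (hT.1 hs)
    · induction c with
      | top => exact le_top
      | coe c => exact WithTop.coe_le_coe.2 (hT.2 fun u hu ↦ WithTop.coe_le_coe.1 (hc hu))
  · refine ⟨⊤, fun _ _ ↦ le_top, fun c hc ↦ ?_⟩
    induction c with
    | top => exact le_rfl
    | coe c => exact absurd ⟨c, hc⟩ htop

variable {R : Type*} [CommRing R]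

/-- The pointwise supremum of a non-empty chain of non-negative valuations is a valuation. -/
theorem exists_addValuation_isLUB {L : Set (AddValuation R (WithTop ℝ))} (hL : L.Nonempty)
    (h0 : ∀ σ ∈ L, ∀ f, 0 ≤ σ f)
    (hchain : ∀ σ ∈ L, ∀ τ ∈ L, (∀ f, σ f ≤ τ f) ∨ ∀ f, τ f ≤ σ f) :
    ∃ v : AddValuation R (WithTop ℝ), ∀ f, IsLUB ((fun σ : AddValuation R (WithTop ℝ) ↦ σ f) '' L)
      (v f) := by
  choose v hv using fun f : R ↦
    exists_isLUB_withTop_real (hL.image fun σ : AddValuation R (WithTop ℝ) ↦ σ f)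
  have hle : ∀ σ ∈ L, ∀ f, σ f ≤ v f := fun σ hσ f ↦ (hv f).1 ⟨σ, hσ, rfl⟩
  have hub : ∀ f c, (∀ σ ∈ L, σ f ≤ c) → v f ≤ c := fun f c h ↦
    (hv f).2 (by rintro _ ⟨σ, hσ, rfl⟩; exact h σ hσ)
  obtain ⟨σ₀, hσ₀⟩ := hL
  refine ⟨AddValuation.of v ?_ ?_ ?_ ?_, hv⟩
  · exact top_le_iff.1 (σ₀.map_zero ▸ hle σ₀ hσ₀ 0)
  · exact le_antisymm (hub 1 0 fun σ _ ↦ σ.map_one.le) (σ₀.map_one ▸ hle σ₀ hσ₀ 1)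
  · intro f g
    by_contra! hlt
    -- The larger of the two approximants `σ`, `τ` exceeds `v (f + g)` at both `f` and `g`.
    obtain ⟨_, ⟨σ, hσ, rfl⟩, h1⟩ := (lt_isLUB_iff (hv f)).1 (hlt.trans_le (min_le_left _ _))
    obtain ⟨_, ⟨τ, hτ, rfl⟩, h2⟩ := (lt_isLUB_iff (hv g)).1 (hlt.trans_le (min_le_right _ _))
    rcases hchain σ hσ τ hτ with h | h
    · exact ((τ.map_lt_add (h1.trans_le (h f)) h2).trans_le (hle τ hτ _)).false
    · exact ((σ.map_lt_add h1 (h2.trans_le (h g))).trans_le (hle σ hσ _)).false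
  · intro f g
    refine le_antisymm (hub _ _ fun σ hσ ↦ ?_) ?_
    · rw [σ.map_mul]
      exact add_le_add (hle σ hσ f) (hle σ hσ g)
    -- The larger of `σ`, `τ` gives a bound with independent indices, so the two suprema can be
    -- taken one after the other; if `v (f * g)` is finite, so are all values involved, and
    -- subtraction is available.
    · have hcross : ∀ σ ∈ L, ∀ τ ∈ L, σ f + τ g ≤ v (f * g) := by
        intro σ hσ τ hτ
        rcases hchain σ hσ τ hτ with h | h
        · exact (add_le_add_left (h f) _).trans (τ.map_mul f g ▸ hle τ hτ _)
        · exact (add_le_add_right (h g) _).trans (σ.map_mul f g ▸ hle σ hσ _)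
      generalize v (f * g) = c at hcross
      induction c with
      | top => exact le_top
      | coe c =>
        have hfc : v f ≤ c := hub f c fun σ hσ ↦
          (le_add_of_nonneg_right (h0 σ hσ g)).trans (hcross σ hσ σ hσ)
        have hgc : v g ≤ c := hub g c fun σ hσ ↦
          (le_add_of_nonneg_left (h0 σ hσ f)).trans (hcross σ hσ σ hσ)
        have hfin : ∀ {a : WithTop ℝ} {b : ℝ}, a ≤ b → ∃ t : ℝ, (t : WithTop ℝ) = a :=
          fun h ↦ WithTop.ne_top_iff_exists.1 (h.trans_lt (WithTop.coe_lt_top _)).ne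
        obtain ⟨q, hq⟩ := hfin hgc
        have hfq : v f ≤ ((c - q : ℝ) : WithTop ℝ) := hub f _ fun σ hσ ↦ by
          obtain ⟨s, hs⟩ := hfin ((hle σ hσ f).trans hfc)
          have hgs : v g ≤ ((c - s : ℝ) : WithTop ℝ) := hub g _ fun τ hτ ↦ by
            obtain ⟨t, ht⟩ := hfin ((hle τ hτ g).trans hgc)
            have := hcross σ hσ τ hτ
            rw [← hs, ← ht, ← WithTop.coe_add, WithTop.coe_le_coe] at this
            rw [← ht, WithTop.coe_le_coe]
            linarith
          rw [← hq, WithTop.coe_le_coe] at hgs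
          rw [← hs, WithTop.coe_le_coe]
          linarith
        obtain ⟨p, hp⟩ := hfin hfq
        rw [← hp, WithTop.coe_le_coe] at hfq
        rw [← hp, ← hq, ← WithTop.coe_add, WithTop.coe_le_coe]
        linarith

variable [IsLocalRing R]

theorem one_le_val (μ : ValuationSpace R) : ∀ f ∈ maximalIdeal R, 1 ≤ μ.val f :=
  fun f hf ↦ μ.normalized.1 ⟨f, hf, rfl⟩

theorem exists_generator_val_eq_one {x y : R} (hm : maximalIdeal R = Ideal.span {x, y})
    (μ : ValuationSpace R) : ∃ x' y', maximalIdeal R = Ideal.span {x', y'} ∧ μ.val x' = 1 := by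
  have hx : x ∈ maximalIdeal R := hm ▸ Ideal.subset_span (by simp)
  have hy : y ∈ maximalIdeal R := hm ▸ Ideal.subset_span (by simp)
  -- The infimum over `𝔪` is attained at one of the two generators.
  have hmin : min (μ.val x) (μ.val y) ≤ 1 := μ.normalized.2 (by
    rintro _ ⟨f, hf, rfl⟩
    rw [SetLike.mem_coe, hm] at hf
    obtain ⟨a, b, rfl⟩ := Ideal.mem_span_pair.1 hf
    refine μ.val.map_le_add ((min_le_left _ _).trans ?_) ((min_le_right _ _).trans ?_) <;>
    · rw [AddValuation.map_mul]
      exact le_add_of_nonneg_left (μ.centered.1 _))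
  rcases min_le_iff.1 hmin with h | h
  · exact ⟨x, y, hm, h.antisymm (one_le_val μ x hx)⟩
  · exact ⟨y, x, by rw [hm, Set.pair_comm], h.antisymm (one_le_val μ y hy)⟩

/-- A non-negative valuation that is at least `1` on the maximal ideal and takes the value `1`
there belongs to the valuation space. -/
def ofMapEqOne (v : AddValuation R (WithTop ℝ)) (h0 : ∀ f, 0 ≤ v f)
    (h1 : ∀ f ∈ maximalIdeal R, 1 ≤ v f) {x : R} (hx : x ∈ maximalIdeal R) (hvx : v x = 1) :
    ValuationSpace R where
  val := v
  centered := ⟨h0, fun f hf ↦ zero_lt_one.trans_le (h1 f hf)⟩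
  proper := by
    constructor
    · intro h
      have hx0 : x ≠ 0 := by
        rintro rfl
        rw [v.map_zero] at hvx
        exact WithTop.top_ne_one hvx
      have : v x ∈ ({0} : Set (WithTop ℝ)) := h ▸ ⟨x, hx0, rfl⟩
      rw [hvx] at this
      exact one_ne_zero this
    · intro h
      have : v x ∈ ({⊤} : Set (WithTop ℝ)) := h ▸ ⟨x, hx, rfl⟩
      rw [hvx] at this
      exact WithTop.one_ne_top this
  normalized := ⟨by rintro _ ⟨f, hf, rfl⟩; exact h1 f hf, fun c hc ↦ hvx ▸ hc ⟨x, hx, rfl⟩⟩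

theorem natCast_le_val_of_mem_pow (μ : ValuationSpace R) {n : ℕ} {f : R}
    (hf : f ∈ maximalIdeal R ^ n) : ((n : ℝ) : WithTop ℝ) ≤ μ.val f := by
  induction n generalizing f with
  | zero => simpa using μ.centered.1 f
  | succ n ih =>
    rw [pow_succ] at hf
    refine Submodule.mul_induction_on hf (fun a ha b hb ↦ ?_) fun a b ha hb ↦
      μ.val.map_le_add ha hb
    rw [μ.val.map_mul]
    push_cast
    exact add_le_add (ih ha) (one_le_val μ b hb)

end Infimum

/-! ### The smallest valuation and the infimum of two valuations. -/

/-- A two-dimensional regular local ring has a smallest normalized valuation, its order. -/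
theorem exists_isBot {R : Type*} [CommRing R] [IsRegularLocalRing R]
    (hdim : ringKrullDim R = 2) : ∃ σ : ValuationSpace R, ∀ μ, σ ≤ μ := by
  obtain ⟨x, y, hm⟩ := exists_maximalIdeal_eq_span_pair (R := R) hdim
  have := isDomain_of_ringKrullDim_eq_two hdim
  have hx : x ∈ maximalIdeal R := hm ▸ Ideal.subset_span (by simp)
  have hy : y ∉ Ideal.span {x} := by simpa using pow_notMem_span_singleton hdim hm 1
  have hx' : x ∉ Ideal.span {y} := by
    simpa using pow_notMem_span_singleton hdim (hm.trans (by rw [Set.pair_comm])) 1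
  have hx0 : x ≠ 0 := fun h ↦ hx' (h ▸ zero_mem _)
  have hp := isPrime_span_singleton hdim hm
  have hx2 : x ∉ maximalIdeal R ^ (1 + 1) := by
    intro h
    -- As a linear form, `x` corresponds to the constant polynomial `1`, whose reduction is
    -- non-zero.
    have hf : formEval x y 1 1 = x := by simp [formEval_eq_sum, Polynomial.coeff_one]
    have := map_residue_eq_zero_of_formEval_mem hm hx0 hp hy (P := 1) (n := 1) (by simp)
      (by rwa [hf])
    simp at this
  have hval : ∀ f, f ≠ 0 → adicValuation hm hx0 hp hy f = ((adicOrder f : ℝ) : WithTop ℝ) :=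
    fun f hf ↦ by simp [adicValuation, hf]
  refine ⟨ofMapEqOne (adicValuation hm hx0 hp hy) (fun f ↦ ?_) (fun f hf ↦ ?_) hx ?_,
    fun μ f ↦ ?_⟩
  · by_cases hf : f = 0
    · simp [hf]
    · rw [hval f hf]
      exact WithTop.coe_le_coe.2 (Nat.cast_nonneg _)
  · by_cases hf0 : f = 0
    · simp [hf0]
    · rw [hval f hf0]
      exact WithTop.coe_le_coe.2 (Nat.one_le_cast.2 ((le_adicOrder_iff hf0).2 (by simpa using hf)))
  · rw [hval x hx0, adicOrder_eq (by simpa using hx) hx2]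
    simp
  · by_cases hf : f = 0
    · simp [hf]
    · change adicValuation hm hx0 hp hy f ≤ _
      rw [hval f hf]
      exact natCast_le_val_of_mem_pow μ (adicOrder_spec hf).1

end ValuationSpace

theorem mainTheorem4 {R : Type*} [CommRing R] [IsRegularLocalRing R]
    (hdim : ringKrullDim R = 2) (μ ν : ValuationSpace R) :
    ∃ σ : ValuationSpace R, IsGLB {μ, ν} σ := by
  obtain ⟨x, y, hm⟩ := ValuationSpace.exists_maximalIdeal_eq_span_pair (R := R) hdim
  obtain ⟨x, y, hm, hμx⟩ := ValuationSpace.exists_generator_val_eq_one hm μ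
  obtain ⟨β, hβ⟩ := ValuationSpace.exists_isBot (R := R) hdim
  have hx : x ∈ maximalIdeal R := hm ▸ Ideal.subset_span (by simp)
  let L : Set (ValuationSpace R) := lowerBounds {μ, ν}
  have hβL : β ∈ L := fun τ _ ↦ hβ τ
  have hLμ : ∀ σ ∈ L, σ ≤ μ := fun σ hσ ↦ hσ (by simp)
  have hLν : ∀ σ ∈ L, σ ≤ ν := fun σ hσ ↦ hσ (by simp)
  obtain ⟨v, hv⟩ := ValuationSpace.exists_addValuation_isLUB
    (L := ValuationSpace.val '' L) ⟨_, β, hβL, rfl⟩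
    (by rintro _ ⟨σ, -, rfl⟩; exact σ.centered.1)
    (by
      rintro _ ⟨σ, hσ, rfl⟩ _ ⟨τ, hτ, rfl⟩
      exact ValuationSpace.le_total_of_le_of_map_eq_one hm σ.centered.1 τ.centered.1
        σ.one_le_val τ.one_le_val (hLμ σ hσ) (hLμ τ hτ) hμx)
  have hle : ∀ σ ∈ L, ∀ f, σ.val f ≤ v f := fun σ hσ f ↦ (hv f).1 ⟨_, ⟨σ, hσ, rfl⟩, rfl⟩
  have hub : ∀ τ : ValuationSpace R, (∀ σ ∈ L, σ ≤ τ) → ∀ f, v f ≤ τ.val f := fun τ hτ f ↦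
    (hv f).2 (by rintro _ ⟨_, ⟨σ, hσ, rfl⟩, rfl⟩; exact hτ σ hσ f)
  have h1 : ∀ f ∈ maximalIdeal R, 1 ≤ v f := fun f hf ↦ (β.one_le_val f hf).trans (hle β hβL f)
  refine ⟨ValuationSpace.ofMapEqOne v (fun f ↦ (β.centered.1 f).trans (hle β hβL f)) h1 hx
    -- The upper bound `μ x = 1` keeps the supremum normalized.
    (((hub μ hLμ x).trans_eq hμx).antisymm (h1 x hx)), ?_, fun σ hσ ↦ hle σ hσ⟩
  rintro τ (rfl | rfl)
  · exact hub _ hLμ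
  · exact hub _ hLν
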